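/- **Setting.** Let $X$ be a reflexive real Banach space such that $X$ and its dual $X^*$ are locally uniformly convex and the norm of $X$ is Fréchet differentiable at every nonzero point. Let $J(x)=\{x^*\in X^*: \langle x^*,x\rangle=\|x\|^2=\|x^*\|^2\}$ be the duality mapping, and $J(S)=\bigcup_{v\in S}J(v)$ for $S\subset X$. For $\Omega\subset X$ and $x\in\Omega$, let $T(x,\Omega)$ be the set of all $v$ for which there are $t_k\to0$, $t_k>0$, and $v_k\to v$ with $x+t_kv_k\in\Omega$ for all $k$. For a subset $S$ of a normed space, $y\in S$ and $\epsilon\ge0$, let $\widehat N_\epsilon(y,S)$ be the set of continuous linear functionals $y^*$ with $\limsup_{z\to y,\,z\in S\setminus\{y\}}\langle y^*,z-y\rangle/\|z-y\|\le\epsilon$. For $f:X\to[-\infty,\infty]$ let $f_\Omega=f$ on $\Omega$ and $f_\Omega=+\infty$ off $\Omega$, let $\operatorname{epi} f_\Omega=\{(x,r)\in X\times\mathbb R: r\ge f_\Omega(x)\}$, and give $X\times\mathbb R$ the norm $\|x\|+|r|$. If $x\in\Omega$ and $f(x)$ is finite, put $$\widehat\partial^{\,\epsilon}_\Omega f(x)=\{x^*\in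 J(T(x,\Omega)): (x^*,-1)\in\widehat N_\epsilon((x,f(x)),\operatorname{epi} f_\Omega)\},$$ and let $\partial_\Omega f(x)$ be the set of all $x^*$ for which there are a nonincreasing sequence $\epsilon_k>0$ with $\epsilon_k\to0$, points $x_k\in\Omega$ with $x_k\to x$ and $f(x_k)\to f(x)$, and $x_k^*\in\widehat\partial^{\,\epsilon_k}_\Omega f(x_k)$ with $x_k^*\to x^*$ weak$^*$. Otherwise both sets are empty. In sums of extended reals, $\infty-\infty=\infty$. **Theorem.** Let $\Omega\subset X$ be closed and convex, and $\bar x\in\Omega$. Let $f_1:X\to[-\infty,\infty]$ be locally Lipschitz relative to $\Omega$ around $\bar x$ with modulus $\ell\ge0$, that is, for some neighbourhood $U$ of $\bar x$, $f_1$ is finite on $U\cap\Omega$ and $|f_1(x)-f_1(u)|\le\ell\|x-u\|$ for all $x,u\in U\cap\Omega$. Let $f_2:X\to[-\infty,\infty]$ be such that, for some neighbourhood $U'$ of $\bar x$, its restriction to $\Omega$ is lower semicontinuous at every point of $U'\cap\Omega$. Suppose that $J(T(x,\Omega))$ is convex for all $x\in\Omega$ near $\bar x$. 1. (Fuzzy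 sum rule.) There are $\epsilon_0>0$ and, for every $M\in\mathbb R$, a function $\omega_M$ with $\omega_M(\eta)\to0$ as $\eta\to0^+$ such that, whenever $0\le\epsilon<\epsilon_0$, $\eta>\epsilon$, and $x^*\in\widehat\partial^{\,\epsilon}_\Omega(f_1+f_2)(\bar x)$ with $\|x^*\|\le M$, there exist $\bar\gamma,\eta_1,\eta_2\in(0,\omega_M(\eta)]$, points $\bar x_1,\bar x_2$ with $\|\bar x_i-\bar x\|\le\eta$ and $|f_i(\bar x_i)-f_i(\bar x)|\le\eta$, and $\bar x_i^*\in\widehat\partial^{\,\eta_i}_\Omega f_i(\bar x_i)$ $(i=1,2)$ with $$\|x^*-\bar x_1^*-\bar x_2^*\|\le\bar\gamma .$$ 2. (Exact sum rule.) $\partial_\Omega(f_1+f_2)(\bar x)\subset\partial_\Omega f_1(\bar x)+\partial_\Omega f_2(\bar x)$. Moreover, the convexity of $J(T(x,\Omega))$ is automatic in Hilbert spaces: if $H$ is a real Hilbert space and $C\subset H$ is convex, then $J(T(x,C))$ is convex for every $x\in C$. -/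

import Mathlib

open Filter Topology
open scoped Pointwise

universe u

namespace RelSubdiff

noncomputable section

/-- Reflexivity: the canonical embedding into the bidual is onto. -/
def IsReflexive (X : Type*) [NormedAddCommGroup X] [NormedSpace ℝ X] : Prop :=
  Function.Surjective (NormedSpace.inclusionInDoubleDual ℝ X)

/-- Local uniform convexity (local uniform rotundity) of the norm. -/
def IsLocallyUniformlyConvex (X : Type*) [NormedAddCommGroup X] : Prop :=
  ∀ x : X, ‖x‖ = 1 → ∀ ε : ℝ, 0 < ε →
    ∃ δ : ℝ, 0 < δ ∧ ∀ y : X, ‖y‖ = 1 → ε ≤ ‖x - y‖ → ‖x + y‖ ≤ 2 - δ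

/-- The norm is Fréchet differentiable at every nonzero point. -/
def HasFrechetNorm (X : Type*) [NormedAddCommGroup X] [NormedSpace ℝ X] : Prop :=
  ∀ x : X, x ≠ 0 → DifferentiableAt ℝ (fun y : X => ‖y‖) x

/-- The duality mapping `J`, as a set-valued map into the dual space. -/
def dualityMap {X : Type*} [NormedAddCommGroup X] [NormedSpace ℝ X] (x : X) :
    Set (StrongDual ℝ X) :=
  {xs | xs x = ‖x‖ ^ 2 ∧ ‖x‖ ^ 2 = ‖xs‖ ^ 2}

/-- The image `J(S)` of a set under the duality mapping. -/
def dualityImage {X : Type*} [NormedAddCommGroup X] [NormedSpace ℝ X] (S : Set X) :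
    Set (StrongDual ℝ X) :=
  ⋃ v ∈ S, dualityMap v

/-- The (Bouligand) tangent cone `T(x, Ω)`. -/
def tangentCone {X : Type*} [NormedAddCommGroup X] [NormedSpace ℝ X] (x : X) (Ω : Set X) :
    Set X :=
  {v | ∃ (t : ℕ → ℝ) (w : ℕ → X), (∀ k, 0 < t k) ∧ Tendsto t atTop (𝓝 0) ∧
    Tendsto w atTop (𝓝 v) ∧ ∀ k, x + t k • w k ∈ Ω}

/-- The set of `ε`-normals to `Ω` at `x`:
functionals `xs` with `limsup ⟨xs, y - x⟩ / ‖y - x‖ ≤ ε` as `y → x`, `y ∈ Ω`, `y ≠ x`. -/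
def epsNormalSet {Y : Type*} [NormedAddCommGroup Y] [NormedSpace ℝ Y] (ε : ℝ) (x : Y)
    (Ω : Set Y) : Set (StrongDual ℝ Y) :=
  {xs | limsup (fun y : Y => ((xs (y - x) / ‖y - x‖ : ℝ) : EReal)) (𝓝[Ω \ {x}] x) ≤ (ε : EReal)}

/-- The epigraph, inside `X × ℝ` with the sum norm `‖(x, r)‖ = ‖x‖ + |r|`. -/
def epi {X : Type*} (f : X → EReal) : Set (WithLp 1 (X × ℝ)) :=
  {p | f p.fst ≤ (p.snd : EReal)}

/-- The functional `(xs, -1)` on `X × ℝ`, i.e. `(x, r) ↦ ⟨xs, x⟩ - r`. -/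
def graphFunctional {X : Type*} [NormedAddCommGroup X] [NormedSpace ℝ X]
    (xs : StrongDual ℝ X) : StrongDual ℝ (WithLp 1 (X × ℝ)) :=
  xs.comp (WithLp.fstL 1 ℝ X ℝ) - WithLp.sndL 1 ℝ X ℝ

/-- The geometric `ε`-subdifferential of `f` at `x`; empty where `f x` is infinite. -/
def geomSubdiff {X : Type*} [NormedAddCommGroup X] [NormedSpace ℝ X] (ε : ℝ) (f : X → EReal)
    (x : X) : Set (StrongDual ℝ X) :=
  {xs | f x ≠ ⊤ ∧ f x ≠ ⊥ ∧
    graphFunctional xs ∈ epsNormalSet ε (WithLp.toLp 1 (x, (f x).toReal)) (epi f)}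

open Classical in
/-- `f_Ω`: equal to `f` on `Ω` and to `+∞` elsewhere. -/
def restrictTop {X : Type*} (f : X → EReal) (Ω : Set X) : X → EReal :=
  fun x => if x ∈ Ω then f x else ⊤

/-- The `ε`-regular subdifferential of `f` relative to `Ω` at `x`;
empty if `x ∉ Ω` or `f x` is infinite. -/
def regSubdiff {X : Type*} [NormedAddCommGroup X] [NormedSpace ℝ X] (ε : ℝ) (Ω : Set X)
    (f : X → EReal) (x : X) : Set (StrongDual ℝ X) :=
  {xs | x ∈ Ω ∧ xs ∈ geomSubdiff ε (restrictTop f Ω) x ∧ xs ∈ dualityImage (tangentCone x Ω)}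

/-- The limiting subdifferential of `f` relative to `Ω` at `x`;
empty if `x ∉ Ω` or `f x` is infinite. -/
def limSubdiff {X : Type*} [NormedAddCommGroup X] [NormedSpace ℝ X] (Ω : Set X)
    (f : X → EReal) (x : X) : Set (StrongDual ℝ X) :=
  {xs | x ∈ Ω ∧ f x ≠ ⊤ ∧ f x ≠ ⊥ ∧
    ∃ (e : ℕ → ℝ) (z : ℕ → X) (zs : ℕ → StrongDual ℝ X),
      (∀ k, 0 < e k) ∧ Antitone e ∧ Tendsto e atTop (𝓝 0) ∧
      (∀ k, z k ∈ Ω) ∧ Tendsto z atTop (𝓝 x) ∧ Tendsto (fun k => f (z k)) atTop (𝓝 (f x)) ∧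
      Tendsto (fun k => StrongDual.toWeakDual (zs k)) atTop (𝓝 (StrongDual.toWeakDual xs)) ∧
      ∀ k, zs k ∈ regSubdiff (e k) Ω f (z k)}

/-- `f` is locally Lipschitz relative to `Ω` around `x` with modulus `ℓ`
(in particular finite on `Ω` near `x`). -/
def LocLipschitzRel {X : Type*} [NormedAddCommGroup X] (f : X → EReal) (Ω : Set X) (x : X)
    (ℓ : ℝ) : Prop :=
  ∃ U ∈ 𝓝 x, (∀ y ∈ U ∩ Ω, f y ≠ ⊤ ∧ f y ≠ ⊥) ∧
    ∀ y ∈ U ∩ Ω, ∀ z ∈ U ∩ Ω, |(f y).toReal - (f z).toReal| ≤ ℓ * ‖y - z‖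

/-- `f` is lower semicontinuous relative to `Ω` at all points of `Ω` near `x`. -/
def LscRelAround {X : Type*} [TopologicalSpace X] (f : X → EReal) (Ω : Set X) (x : X) : Prop :=
  ∃ U ∈ 𝓝 x, ∀ y ∈ U ∩ Ω, LowerSemicontinuousWithinAt f Ω y

open Classical in
/-- Pointwise sum of extended-real-valued functions, with the convention `∞ - ∞ = ∞`. -/
def addTop {X : Type*} (f g : X → EReal) : X → EReal :=
  fun x => if f x = ⊤ ∨ g x = ⊤ then ⊤ else f x + g x

end

end RelSubdiff

/-!
The sum rule is proved by doubling variables. A subgradient `x*` of `f₁ + f₂` at `x̄` relative to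
`Ω` makes `x̄` an approximate local minimum over `Ω` of `f₁ + f₂ - x*`
(`eventually_of_mem_geomSubdiff`). Separating the variables of `f₁` and `f₂` and penalizing with
`k / 2 * ‖x - y‖²`, a variational principle (`exists_phelps_minimal`) yields approximate minima
`(x, y) ∈ Ω × Ω` close to `(x̄, x̄)` (`exists_decoupled_minimum`). The penalty is differentiable with
gradient given by the duality mapping `J`, so `J (k (y - x))` is an approximate subgradient of `f₁`
at `x`, and `x* + J (k (x - y))` is one of `f₂` at `y`.

It remains to place these functionals in `J (T (x, Ω))` and `J (T (y, Ω))`. Since `Ω` is convex,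
`y - x` and `x - y` are tangent at `x` and at `y` respectively, which settles the penalty terms. The
functional `x*` equals `J v` with `v` tangent at `x̄`; as `v` is a limit of vectors `t (u - x̄)` with
`u ∈ Ω` and `J` is norm continuous, `x*` is close to `J (t (u - y))`, where `t (u - y)` is tangent
at `y` (`exists_dualityGrad_approx`). Convexity of the cone `J (T (y, Ω))` then allows adding it to
`J (k (x - y))`. All errors are at most `(6 + 2 ‖x*‖) η` (`exists_fuzzy_sum`).

For the exact rule, the Lipschitz property of `f₁` bounds `k ‖x - y‖` independently of `k`, so the
first summands stay bounded. Reflexivity gives them a weak* convergent subsequence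
(`exists_weakStar_convergent_subseq`), and the second summands follow. In a Hilbert space `J` is the
Riesz isometry, so `J (T (x, C))` is convex because `T (x, C)` is.
-/

open Filter Topology
open scoped Pointwise

namespace RelSubdiff

/-! ### Weak* sequential compactness in the dual of a reflexive space -/

/-- Hahn–Banach separation of a point from a closed subspace. -/
theorem exists_dual_vanishing_of_notMem {E : Type*} [NormedAddCommGroup E] [NormedSpace ℝ E]
    {W : Submodule ℝ E} (hW : IsClosed (W : Set E)) {x : E} (hx : x ∉ W) :
    ∃ f : StrongDual ℝ E, (∀ w ∈ W, f w = 0) ∧ f x ≠ 0 := by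
  obtain ⟨f, u, hf, hu⟩ := geometric_hahn_banach_closed_point W.convex hW hx
  have hu0 : 0 < u := by simpa using hf 0 W.zero_mem
  refine ⟨f, fun w hw => ?_, (hu0.trans hu).ne'⟩
  by_contra h
  have := hf ((u / f w) • w) (W.smul_mem _ hw)
  simp [h] at this

theorem exists_norming_vector {E : Type*} [NormedAddCommGroup E] [NormedSpace ℝ E]
    (f : StrongDual ℝ E) : ∃ x : E, ‖x‖ ≤ 1 ∧ ‖f‖ / 2 ≤ |f x| := by
  rcases eq_or_ne f 0 with rfl | hf
  · exact ⟨0, by simp, by simp⟩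
  · have hpos : 0 < ‖f‖ := norm_pos_iff.2 hf
    obtain ⟨x, hx, hfx⟩ := f.exists_lt_apply_of_lt_opNorm (half_lt_self hpos)
    exact ⟨x, hx.le, by simpa using hfx.le⟩

theorem cauchySeq_eval_of_mem_closure {X : Type*} [NormedAddCommGroup X] [NormedSpace ℝ X]
    {g : ℕ → StrongDual ℝ X} {B : ℝ} (hB : ∀ n, ‖g n‖ ≤ B) {D : Set X}
    (hD : ∀ x ∈ D, CauchySeq fun n => g n x) {x : X} (hx : x ∈ closure D) :
    CauchySeq fun n => g n x := by
  have hB0 : 0 ≤ B := (norm_nonneg _).trans (hB 0)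
  rw [Metric.cauchySeq_iff]
  intro ε hε
  obtain ⟨d, hd, hxd⟩ := Metric.mem_closure_iff.1 hx (ε / (3 * (B + 1))) (by positivity)
  obtain ⟨N, hN⟩ := Metric.cauchySeq_iff.1 (hD d hd) (ε / 3) (by positivity)
  refine ⟨N, fun m hm n hn => ?_⟩
  have key : ∀ k, dist (g k x) (g k d) ≤ ε / 3 := by
    intro k
    rw [dist_eq_norm, ← map_sub]
    calc ‖g k (x - d)‖ ≤ ‖g k‖ * ‖x - d‖ := (g k).le_opNorm _
      _ ≤ (B + 1) * (ε / (3 * (B + 1))) := by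
          rw [dist_eq_norm] at hxd
          gcongr
          linarith [hB k]
      _ = ε / 3 := by field_simp
  have h1 := key m
  have h2 := key n
  have h3 := hN m hm n hn
  have h4 := dist_triangle4_right (g m x) (g n x) (g m d) (g n d)
  linarith

/-- Every norm-bounded sequence in the dual of a reflexive space has a weak* convergent
subsequence. A diagonal argument gives convergence on countably many vectors norming the closed
span `Y` of the sequence, and the values on the preannihilator of `Y` are all zero. By reflexivity
these vectors together span a dense subspace. -/
theorem exists_weakStar_convergent_subseq {X : Type*} [NormedAddCommGroup X] [NormedSpace ℝ X]
    [CompleteSpace X] (hrefl : IsReflexive X) {g : ℕ → StrongDual ℝ X} {B : ℝ}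
    (hB : ∀ n, ‖g n‖ ≤ B) :
    ∃ (g₀ : StrongDual ℝ X) (φ : ℕ → ℕ), StrictMono φ ∧
      Tendsto (fun k => StrongDual.toWeakDual (g (φ k))) atTop
        (𝓝 (StrongDual.toWeakDual g₀)) := by
  set Y : Submodule ℝ (StrongDual ℝ X) := (Submodule.span ℝ (Set.range g)).topologicalClosure
  have hgY : ∀ n, g n ∈ Y := fun n =>
    Submodule.le_topologicalClosure _ (Submodule.subset_span ⟨n, rfl⟩)
  have hYsep : TopologicalSpace.IsSeparable (Y : Set (StrongDual ℝ X)) :=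
    ((Set.countable_range g).isSeparable.span (R := ℝ)).closure
  obtain ⟨c, hc, hYc⟩ := hYsep
  choose p hp1 hp2 using fun f : StrongDual ℝ X => exists_norming_vector f
  have : Countable c := hc.to_subtype
  -- a subsequence converging at the countably many vectors `p y`, `y ∈ c`
  obtain ⟨a, -, φ, hφ, hlim⟩ := (isCompact_univ_pi fun _ : c => isCompact_Icc (a := -B)
    (b := B)).tendsto_subseq (x := fun n (y : c) => g n (p y)) (by
      intro n y _
      rw [Set.mem_Icc, ← abs_le]
      calc |g n (p y)| ≤ ‖g n‖ * ‖p y‖ := (g n).le_opNorm _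
        _ ≤ ‖g n‖ * 1 := by gcongr; exact hp1 _
        _ ≤ B := by simpa using hB n)
  rw [tendsto_pi_nhds] at hlim
  let V : Submodule ℝ X :=
    { carrier := {x | CauchySeq fun k => g (φ k) x}
      add_mem' := fun {x y} hx hy => by
        simpa [Pi.add_def] using CauchySeq.add hx hy
      zero_mem' := by simpa using cauchySeq_const (0 : ℝ)
      smul_mem' := fun r x hx => by
        simpa [Function.comp_def] using (uniformContinuous_const_smul r).comp_cauchySeq hx }
  have hVclosed : IsClosed (V : Set X) := isClosed_of_closure_subset fun x hx =>
    cauchySeq_eval_of_mem_closure (fun n => hB (φ n)) (fun _ h => h) hx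
  have hVtop : ∀ x, x ∈ V := by
    by_contra! ⟨x, hx⟩
    obtain ⟨f, hf, hfx⟩ := exists_dual_vanishing_of_notMem hVclosed hx
    -- by reflexivity, a functional vanishing on the preannihilator of `Y` lies in `Y`
    have hfY : f ∈ Y := by
      by_contra hfY
      obtain ⟨F, hF, hFf⟩ := exists_dual_vanishing_of_notMem
        (Submodule.isClosed_topologicalClosure _) hfY
      obtain ⟨z, rfl⟩ := hrefl F
      refine hFf (hf z ?_)
      have : ∀ k, g (φ k) z = 0 := fun k => hF _ (hgY _)
      change CauchySeq fun k => g (φ k) z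
      simpa [this] using cauchySeq_const (0 : ℝ)
    have hf0 : f = 0 := by
      rw [← norm_le_zero_iff]
      refine le_of_forall_pos_le_add fun ε hε => ?_
      obtain ⟨y, hy, hfy⟩ := Metric.mem_closure_iff.1 (hYc hfY) (ε / 3) (by positivity)
      have hfp : f (p y) = 0 := hf _ (hlim ⟨y, hy⟩).cauchySeq
      have h1 : |y (p y)| ≤ ‖y - f‖ := by
        have : y (p y) = (y - f) (p y) := by simp [hfp]
        rw [this]
        exact ((y - f).le_opNorm _).trans (mul_le_of_le_one_right (norm_nonneg _) (hp1 y))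
      have h2 := hp2 y
      have h3 : ‖f‖ ≤ ‖y‖ + ‖f - y‖ := by simpa using norm_add_le y (f - y)
      rw [dist_eq_norm] at hfy
      rw [norm_sub_rev] at h1
      linarith
    simp [hf0] at hfx
  choose l hl using fun x => cauchySeq_tendsto_of_complete (hVtop x)
  refine ⟨continuousLinearMapOfTendsto (fun k => g (φ k)) (tendsto_pi_nhds.2 hl), φ, hφ, ?_⟩
  rw [tendsto_iff_forall_eval_tendsto_topDualPairing]
  exact hl

/-- Weak* convergent sequences are norm bounded (uniform boundedness principle). -/
theorem exists_norm_bound_of_weakStar_tendsto {X : Type*} [NormedAddCommGroup X]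
    [NormedSpace ℝ X] [CompleteSpace X] {g : ℕ → StrongDual ℝ X} {g₀ : StrongDual ℝ X}
    (h : Tendsto (fun k => StrongDual.toWeakDual (g k)) atTop
      (𝓝 (StrongDual.toWeakDual g₀))) : ∃ M, ∀ k, ‖g k‖ ≤ M := by
  rw [tendsto_iff_forall_eval_tendsto_topDualPairing] at h
  refine banach_steinhaus fun x => ?_
  obtain ⟨C, hC⟩ := (h x).norm.bddAbove_range
  exact ⟨C, fun n => hC ⟨n, rfl⟩⟩

/-! ### The duality mapping as the gradient of half the squared norm -/

theorem dualityMap_nonempty {X : Type*} [NormedAddCommGroup X] [NormedSpace ℝ X] (x : X) :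
    (dualityMap x).Nonempty := by
  rcases eq_or_ne x 0 with rfl | hx
  · exact ⟨0, by simp [dualityMap]⟩
  · obtain ⟨g, hg, hgx⟩ := exists_dual_vector ℝ x (norm_ne_zero_iff.2 hx)
    refine ⟨‖x‖ • g, ?_, ?_⟩
    · have : g x = ‖x‖ := by simpa using hgx
      simp [this, sq]
    · simp [norm_smul, hg]

theorem smul_mem_dualityMap {X : Type*} [NormedAddCommGroup X] [NormedSpace ℝ X] {v : X}
    {xs : StrongDual ℝ X} (h : xs ∈ dualityMap v) (s : ℝ) :
    s • xs ∈ dualityMap (s • v) := by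
  obtain ⟨h1, h2⟩ := h
  refine ⟨?_, ?_⟩
  · simp [norm_smul, mul_pow, h1]
    ring
  · simp [norm_smul, mul_pow, h2]

/-- The elements of `J x` are subgradients of `‖·‖² / 2` at `x`. -/
theorem le_of_mem_dualityMap {X : Type*} [NormedAddCommGroup X] [NormedSpace ℝ X] {x : X}
    {xs : StrongDual ℝ X} (h : xs ∈ dualityMap x) (y : X) :
    xs (y - x) ≤ ‖y‖ ^ 2 / 2 - ‖x‖ ^ 2 / 2 := by
  have h1 : xs y ≤ ‖xs‖ * ‖y‖ := (le_abs_self _).trans (xs.le_opNorm y)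
  have h2 := h.1
  have h3 := h.2
  rw [map_sub]
  nlinarith [sq_nonneg (‖xs‖ - ‖y‖)]

theorem HasFrechetNorm.differentiable {X : Type*} [NormedAddCommGroup X] [NormedSpace ℝ X]
    (h : HasFrechetNorm X) : Differentiable ℝ fun x : X => ‖x‖ ^ 2 / 2 := by
  intro x
  rcases eq_or_ne x 0 with rfl | hx
  · have : HasFDerivAt (fun x : X => ‖x‖ ^ 2 / 2) (0 : StrongDual ℝ X) 0 := by
      rw [hasFDerivAt_iff_isLittleO_nhds_zero]
      have h2 : (fun h : X => ‖h‖ ^ 2) =o[𝓝 0] fun h => h := by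
        simpa using (Asymptotics.isLittleO_norm_pow_id (E' := X) one_lt_two)
      simpa [div_eq_inv_mul] using h2.const_mul_left (2⁻¹ : ℝ)
    exact this.differentiableAt
  · exact ((h x hx).fun_pow 2).mul_const 2⁻¹

/-- The gradient of `‖·‖² / 2`. When the norm is Fréchet differentiable this is the unique
element of the duality mapping, see `HasFrechetNorm.eq_dualityGrad`. -/
noncomputable def dualityGrad {X : Type*} [NormedAddCommGroup X] [NormedSpace ℝ X] (x : X) :
    StrongDual ℝ X :=
  fderiv ℝ (fun y : X => ‖y‖ ^ 2 / 2) x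

theorem HasFrechetNorm.eq_dualityGrad {X : Type*} [NormedAddCommGroup X] [NormedSpace ℝ X]
    (h : HasFrechetNorm X) {x : X} {xs : StrongDual ℝ X} (hxs : xs ∈ dualityMap x) :
    xs = dualityGrad x := by
  have hmin : IsLocalMin (fun y : X => ‖y‖ ^ 2 / 2 - xs y) x :=
    Eventually.of_forall fun y => by
      have := le_of_mem_dualityMap hxs y
      rw [map_sub] at this
      linarith
  have := ((h.differentiable x).hasFDerivAt.sub xs.hasFDerivAt).fderiv ▸ hmin.fderiv_eq_zero
  exact (sub_eq_zero.1 this).symm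

theorem HasFrechetNorm.dualityGrad_mem {X : Type*} [NormedAddCommGroup X] [NormedSpace ℝ X]
    (h : HasFrechetNorm X) (x : X) : dualityGrad x ∈ dualityMap x := by
  obtain ⟨xs, hxs⟩ := dualityMap_nonempty x
  exact h.eq_dualityGrad hxs ▸ hxs

theorem HasFrechetNorm.norm_dualityGrad {X : Type*} [NormedAddCommGroup X] [NormedSpace ℝ X]
    (h : HasFrechetNorm X) (x : X) : ‖dualityGrad x‖ = ‖x‖ :=
  ((sq_eq_sq₀ (norm_nonneg _) (norm_nonneg _)).1 (h.dualityGrad_mem x).2).symm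

theorem HasFrechetNorm.dualityGrad_smul {X : Type*} [NormedAddCommGroup X] [NormedSpace ℝ X]
    (h : HasFrechetNorm X) (c : ℝ) (x : X) : dualityGrad (c • x) = c • dualityGrad x :=
  (h.eq_dualityGrad (smul_mem_dualityMap (h.dualityGrad_mem x) c)).symm

theorem HasFrechetNorm.dualityGrad_neg {X : Type*} [NormedAddCommGroup X] [NormedSpace ℝ X]
    (h : HasFrechetNorm X) (x : X) : dualityGrad (-x) = -dualityGrad x := by
  obtain ⟨h1, h2⟩ := h.dualityGrad_mem x
  exact (h.eq_dualityGrad ⟨by simp [h1], by simp [h2]⟩).symm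

/-- The duality mapping is norm-to-norm continuous: the gradient of a Fréchet differentiable
convex function is continuous. -/
theorem HasFrechetNorm.continuous_dualityGrad {X : Type*} [NormedAddCommGroup X]
    [NormedSpace ℝ X] (h : HasFrechetNorm X) :
    Continuous (dualityGrad : X → StrongDual ℝ X) := by
  refine continuous_iff_continuousAt.2 fun v => Metric.continuousAt_iff.2 fun ε hε => ?_
  have hd := (h.differentiable v).hasFDerivAt.isLittleO.def (show 0 < ε / 6 by positivity)
  obtain ⟨r, hr, hball⟩ := Metric.eventually_nhds_iff_ball.1 hd
  refine ⟨r / 3, by positivity, fun {w} hw => ?_⟩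
  have hw' : ‖w - v‖ < r / 3 := by simpa [dist_eq_norm] using hw
  rw [dist_eq_norm]
  have hone : ∀ y : X, ‖y‖ ≤ r / 3 → (dualityGrad w - dualityGrad v) y ≤ ε / 6 * r := by
    intro y hy
    have h1 := le_of_mem_dualityMap (h.dualityGrad_mem w) (w + y)
    have h2 := hball (w + y) (by
      rw [mem_ball_iff_norm]
      calc ‖w + y - v‖ = ‖(w - v) + y‖ := by congr 1; abel
        _ ≤ ‖w - v‖ + ‖y‖ := norm_add_le _ _
        _ < r := by linarith)
    have h3 := hball w (by rw [mem_ball_iff_norm]; linarith)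
    have h4 : ‖w + y - v‖ ≤ ‖w - v‖ + ‖y‖ := by
      calc ‖w + y - v‖ = ‖(w - v) + y‖ := by congr 1; abel
        _ ≤ _ := norm_add_le _ _
    rw [Real.norm_eq_abs, abs_le] at h2 h3
    have h5 : fderiv ℝ (fun y : X => ‖y‖ ^ 2 / 2) v = dualityGrad v := rfl
    rw [h5] at h2 h3
    simp only [add_sub_cancel_left, map_add, map_sub, sub_apply] at *
    have h6 : ε / 6 * ‖w + y - v‖ ≤ ε / 6 * (‖w - v‖ + ‖y‖) := by gcongr
    have h7 : ε / 6 * (‖w - v‖ + ‖y‖) + ε / 6 * ‖w - v‖ ≤ ε / 6 * r := by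
      rw [← mul_add]; gcongr; linarith
    linarith
  have hle : ‖dualityGrad w - dualityGrad v‖ ≤ ε / 2 := by
    refine ContinuousLinearMap.opNorm_le_of_unit_norm (by positivity) fun y hy => ?_
    have hn : ‖(r / 3) • y‖ ≤ r / 3 := by rw [norm_smul, hy, Real.norm_of_nonneg] <;> linarith
    have h1 := hone ((r / 3) • y) hn
    have h2 := hone (-((r / 3) • y)) (by rwa [norm_neg])
    rw [map_neg] at h2
    rw [map_smul, smul_eq_mul] at h1 h2
    rw [Real.norm_eq_abs, abs_le]
    constructor <;> nlinarith
  linarith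

/-! ### Tangent cones of convex sets and their duality images -/

theorem smul_sub_mem_tangentCone {X : Type*} [NormedAddCommGroup X] [NormedSpace ℝ X]
    {C : Set X} (hC : Convex ℝ C) {x c : X} (hx : x ∈ C) (hc : c ∈ C) {s : ℝ} (hs : 0 < s) :
    s • (c - x) ∈ tangentCone x C := by
  refine ⟨fun n => s⁻¹ * (1 / ((n : ℝ) + 1)), fun _ => s • (c - x), fun n => by positivity, ?_,
    tendsto_const_nhds, fun n => ?_⟩
  · simpa using tendsto_one_div_add_atTop_nhds_zero_nat.const_mul s⁻¹
  · have h : (s⁻¹ * (1 / ((n : ℝ) + 1))) • s • (c - x) = (1 / ((n : ℝ) + 1)) • (c - x) := by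
      rw [smul_smul]; congr 1; field_simp
    rw [h]
    refine hC.add_smul_sub_mem hx hc ⟨by positivity, ?_⟩
    rw [div_le_one (by positivity)]
    simp

/-- The tangent cone of a convex set is the closure of the cone of feasible directions. -/
theorem tangentCone_eq_closure {X : Type*} [NormedAddCommGroup X] [NormedSpace ℝ X]
    {C : Set X} (hC : Convex ℝ C) {x : X} (hx : x ∈ C) :
    tangentCone x C = closure {v | ∃ s : ℝ, 0 < s ∧ ∃ c ∈ C, v = s • (c - x)} := by
  apply Set.Subset.antisymm
  · rintro v ⟨t, w, ht, -, hw, hmem⟩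
    refine mem_closure_of_tendsto hw (Eventually.of_forall fun k => ?_)
    refine ⟨(t k)⁻¹, inv_pos.2 (ht k), _, hmem k, ?_⟩
    rw [add_sub_cancel_left, inv_smul_smul₀ (ht k).ne']
  · intro v hv
    obtain ⟨w, hw, hlim⟩ := mem_closure_iff_seq_limit.1 hv
    choose s hs c hc hwc using hw
    refine ⟨fun n => min (s n)⁻¹ (1 / ((n : ℝ) + 1)), w, fun n => ?_, ?_, hlim, fun n => ?_⟩
    · exact lt_min (inv_pos.2 (hs n)) (by positivity)
    · refine squeeze_zero (fun n => ?_) (fun n => min_le_right _ _)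
        tendsto_one_div_add_atTop_nhds_zero_nat
      exact (lt_min (inv_pos.2 (hs n)) (by positivity)).le
    · change x + min (s n)⁻¹ (1 / ((n : ℝ) + 1)) • w n ∈ C
      rw [hwc n, smul_smul]
      refine hC.add_smul_sub_mem hx (hc n) ⟨?_, ?_⟩
      · exact mul_nonneg (lt_min (inv_pos.2 (hs n)) (by positivity)).le (hs n).le
      · calc min (s n)⁻¹ (1 / ((n : ℝ) + 1)) * s n ≤ (s n)⁻¹ * s n :=
              mul_le_mul_of_nonneg_right (min_le_left _ _) (hs n).le
          _ = 1 := inv_mul_cancel₀ (hs n).ne'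

theorem convex_tangentCone {X : Type*} [NormedAddCommGroup X] [NormedSpace ℝ X]
    {C : Set X} (hC : Convex ℝ C) {x : X} (hx : x ∈ C) : Convex ℝ (tangentCone x C) := by
  rw [tangentCone_eq_closure hC hx]
  refine Convex.closure ?_
  rw [convex_iff_forall_pos]
  rintro _ ⟨s, hs, c, hc, rfl⟩ _ ⟨t, ht, d, hd, rfl⟩ a b ha hb -
  have hpos : 0 < a * s + b * t := by positivity
  refine ⟨a * s + b * t, hpos, (a * s / (a * s + b * t)) • c + (b * t / (a * s + b * t)) • d,
    hC hc hd (by positivity) (by positivity) (by field_simp), ?_⟩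
  match_scalars <;> field_simp
  ring

theorem smul_mem_tangentCone {X : Type*} [NormedAddCommGroup X] [NormedSpace ℝ X]
    {C : Set X} {x v : X} (hv : v ∈ tangentCone x C) {s : ℝ} (hs : 0 < s) :
    s • v ∈ tangentCone x C := by
  obtain ⟨t, w, ht, ht0, hw, hmem⟩ := hv
  refine ⟨fun n => s⁻¹ * t n, fun n => s • w n, fun n => mul_pos (inv_pos.2 hs) (ht n), ?_,
    hw.const_smul s, fun n => ?_⟩
  · simpa using ht0.const_mul s⁻¹
  · change x + (s⁻¹ * t n) • s • w n ∈ C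
    rw [smul_smul, mul_right_comm, inv_mul_cancel₀ hs.ne', one_mul]
    exact hmem n

/-- A convex duality image of a tangent cone is closed under addition, being a cone. -/
theorem add_mem_dualityImage_tangentCone {X : Type*} [NormedAddCommGroup X] [NormedSpace ℝ X]
    {C : Set X} {x : X} (hconv : Convex ℝ (dualityImage (tangentCone x C)))
    {p q : StrongDual ℝ X} (hp : p ∈ dualityImage (tangentCone x C))
    (hq : q ∈ dualityImage (tangentCone x C)) : p + q ∈ dualityImage (tangentCone x C) := by
  have htwo : ∀ r ∈ dualityImage (tangentCone x C),
      (2 : ℝ) • r ∈ dualityImage (tangentCone x C) := by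
    intro r hr
    obtain ⟨v, hv, hrv⟩ := Set.mem_iUnion₂.1 hr
    exact Set.mem_iUnion₂.2 ⟨_, smul_mem_tangentCone hv two_pos, smul_mem_dualityMap hrv 2⟩
  have h := hconv (htwo p hp) (htwo q hq) (a := 1 / 2) (b := 1 / 2) (by norm_num) (by norm_num)
    (by norm_num)
  simpa [smul_smul] using h

theorem dualityMap_eq_singleton_of_inner {H : Type*} [NormedAddCommGroup H]
    [InnerProductSpace ℝ H] [CompleteSpace H] (v : H) :
    dualityMap v = {InnerProductSpace.toDual ℝ H v} := by
  ext xs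
  obtain ⟨w, rfl⟩ := (InnerProductSpace.toDual ℝ H).surjective xs
  simp only [dualityMap, Set.mem_ofPred_eq, InnerProductSpace.toDual_apply_apply,
    LinearIsometryEquiv.norm_map, Set.mem_singleton_iff, EmbeddingLike.apply_eq_iff_eq]
  constructor
  · rintro ⟨h1, h2⟩
    have h3 := norm_sub_sq_real w v
    rw [h1, ← h2] at h3
    have h4 : ‖w - v‖ = 0 := by
      have : ‖w - v‖ ^ 2 = 0 := by linarith
      simpa using this
    exact sub_eq_zero.1 (norm_eq_zero.1 h4)
  · rintro rfl
    exact ⟨real_inner_self_eq_norm_sq _, rfl⟩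

theorem convex_dualityImage_tangentCone_of_inner {H : Type*} [NormedAddCommGroup H]
    [InnerProductSpace ℝ H] [CompleteSpace H] {C : Set H} (hC : Convex ℝ C) {x : H}
    (hx : x ∈ C) : Convex ℝ (dualityImage (tangentCone x C)) := by
  have h : dualityImage (tangentCone x C) =
      (InnerProductSpace.toDualMap ℝ H).toLinearMap '' tangentCone x C := by
    ext xs
    simp only [dualityImage, dualityMap_eq_singleton_of_inner, Set.mem_iUnion,
      Set.mem_singleton_iff, Set.mem_image, exists_prop]
    exact exists_congr fun v => and_congr_right fun _ => eq_comm
  rw [h]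
  exact (convex_tangentCone hC hx).linear_image _

/-! ### A variational principle and the analytic form of the subdifferential -/

/-- Ekeland's variational principle in the form of Phelps: a closed subset of `α × ℝ`, bounded
below in the second coordinate, contains a point minimal up to the cone of slope `δ`. For the
epigraph of an extended-real-valued lower semicontinuous function this avoids infinite values. -/
theorem exists_phelps_minimal {α : Type*} [MetricSpace α] [CompleteSpace α] {E : Set (α × ℝ)}
    (hE : IsClosed E) {m : ℝ} (hm : ∀ p ∈ E, m ≤ p.2) {p₀ : α × ℝ} (hp₀ : p₀ ∈ E) {δ : ℝ}
    (hδ : 0 < δ) :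
    ∃ p ∈ E, p.2 ≤ p₀.2 ∧ ∀ q ∈ E, p.2 ≤ q.2 + δ * dist q.1 p.1 := by
  -- `A p` is the set of points below `p` in the order given by the cone of slope `δ`
  let A : α × ℝ → Set (α × ℝ) := fun p => {q | q ∈ E ∧ δ * dist q.1 p.1 ≤ p.2 - q.2}
  have hself : ∀ p ∈ E, p ∈ A p := fun p hp => ⟨hp, by simp⟩
  have htrans : ∀ {p q r}, q ∈ A p → r ∈ A q → r ∈ A p := by
    rintro p q r ⟨-, hq⟩ ⟨hrE, hr⟩
    refine ⟨hrE, ?_⟩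
    have := mul_le_mul_of_nonneg_left (dist_triangle r.1 q.1 p.1) hδ.le
    linarith
  have hstep : ∀ (n : ℕ) (p : E), ∃ q : E, (q : α × ℝ) ∈ A p ∧
      ∀ r ∈ A p, (q : α × ℝ).2 ≤ r.2 + 1 / ((n : ℝ) + 1) := by
    intro n p
    have hbdd : BddBelow (Prod.snd '' A p) := ⟨m, by rintro _ ⟨q, hq, rfl⟩; exact hm q hq.1⟩
    obtain ⟨_, ⟨q, hq, rfl⟩, hlt⟩ := exists_lt_of_csInf_lt
      (Set.Nonempty.image Prod.snd ⟨_, hself p p.2⟩)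
      (lt_add_of_pos_right (sInf (Prod.snd '' A p)) (show 0 < 1 / ((n : ℝ) + 1) by positivity))
    refine ⟨⟨q, hq.1⟩, hq, fun r hr => ?_⟩
    have := csInf_le hbdd ⟨r, hr, rfl⟩
    exact hlt.le.trans (by simpa using this)
  choose nxt hnxt hinf using hstep
  let u : ℕ → E := fun n => Nat.rec ⟨p₀, hp₀⟩ nxt n
  have hu : ∀ n, u (n + 1) = nxt n (u n) := fun n => rfl
  have hmem : ∀ n k : ℕ, (u (n + k)).1 ∈ A (u n).1 := by
    intro n k
    induction k with
    | zero => exact hself _ (u n).2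
    | succ k ih => exact htrans ih (by rw [← add_assoc, hu]; exact hnxt _ _)
  have hanti : Antitone fun n : ℕ => (u n).1.2 := antitone_nat_of_succ_le fun n => by
    have := (hmem n 1).2
    have h2 : 0 ≤ δ * dist (u (n + 1)).1.1 (u n).1.1 := by positivity
    linarith
  have hbdd : BddBelow (Set.range fun n : ℕ => (u n).1.2) :=
    ⟨m, by rintro _ ⟨n, rfl⟩; exact hm _ (u n).2⟩
  have hr := tendsto_atTop_ciInf hanti hbdd
  set r := ⨅ n : ℕ, (u n).1.2
  have hcauchy : CauchySeq fun n : ℕ => (u n).1.1 := by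
    refine Metric.cauchySeq_iff'.2 fun ε hε => ?_
    obtain ⟨N, hN⟩ := Metric.cauchySeq_iff'.1 hr.cauchySeq (δ * ε) (by positivity)
    refine ⟨N, fun n hn => ?_⟩
    obtain ⟨k, rfl⟩ := Nat.exists_eq_add_of_le hn
    have h1 := (hmem N k).2
    have h2 := hN _ hn
    rw [Real.dist_eq, abs_sub_comm] at h2
    exact lt_of_mul_lt_mul_left (h1.trans_lt ((le_abs_self _).trans_lt h2)) hδ.le
  obtain ⟨z, hz⟩ := cauchySeq_tendsto_of_complete hcauchy
  have hlim : Tendsto (fun n : ℕ => (u n).1) atTop (𝓝 (z, r)) := hz.prodMk_nhds hr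
  have hzA : ∀ n : ℕ, (z, r) ∈ A (u n).1 := by
    intro n
    have hcl : IsClosed (A (u n).1) :=
      hE.inter (isClosed_le (f := fun q : α × ℝ => δ * dist q.1 (u n).1.1)
        (g := fun q => (u n).1.2 - q.2) (by fun_prop) (by fun_prop))
    refine hcl.mem_of_tendsto hlim (eventually_atTop.2 ⟨n, fun k hk => ?_⟩)
    obtain ⟨j, rfl⟩ := Nat.exists_eq_add_of_le hk
    exact hmem n j
  have hmin : ∀ q ∈ A (z, r), r ≤ q.2 := by
    intro q hq
    have hle : ∀ n : ℕ, r ≤ q.2 + 1 / ((n : ℝ) + 1) := fun n =>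
      (ciInf_le hbdd (n + 1)).trans (by
        have := hinf n (u n) q (htrans (hzA n) hq)
        rwa [← hu] at this)
    simpa using ge_of_tendsto'
      (tendsto_const_nhds.add tendsto_one_div_add_atTop_nhds_zero_nat) hle
  refine ⟨(z, r), (hzA 0).1, hanti.le_of_tendsto hr 0, fun q hq => ?_⟩
  by_contra! hlt
  have hd : 0 ≤ δ * dist q.1 z := by positivity
  have := hmin q ⟨hq, by simp only at hlt ⊢; linarith⟩
  simp only at hlt
  linarith

theorem norm_eq_fst_add_abs_snd {X : Type*} [NormedAddCommGroup X] (p : WithLp 1 (X × ℝ)) :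
    ‖p‖ = ‖p.fst‖ + |p.snd| := by
  rw [WithLp.prod_norm_eq_of_L1, Real.norm_eq_abs]

/-- An analytic `e`-subgradient is a geometric one. Values of `f` enter only through real upper
bounds `s`, so that `f` may be infinite near `x`. -/
theorem mem_geomSubdiff_of_eventually {X : Type*} [NormedAddCommGroup X] [NormedSpace ℝ X]
    {f : X → EReal} {x : X} {r e : ℝ} {q : StrongDual ℝ X} (hfx : f x = (r : EReal)) (he : 0 ≤ e)
    (h : ∀ᶠ z in 𝓝 x, ∀ s : ℝ, f z ≤ s → r + q (z - x) - e * ‖z - x‖ ≤ s) :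
    q ∈ geomSubdiff e f x := by
  refine ⟨by simp [hfx], by simp [hfx], ?_⟩
  rw [epsNormalSet, Set.mem_ofPred_eq]
  refine limsup_le_of_le (h := ?_)
  have hfst : Tendsto (fun p : WithLp 1 (X × ℝ) => p.fst)
      (𝓝[epi f \ {WithLp.toLp 1 (x, (f x).toReal)}] (WithLp.toLp 1 (x, (f x).toReal))) (𝓝 x) := by
    have : Continuous fun p : WithLp 1 (X × ℝ) => p.fst := (WithLp.fstL 1 ℝ X ℝ).continuous
    exact (this.tendsto (WithLp.toLp 1 (x, (f x).toReal))).mono_left nhdsWithin_le_nhds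
  filter_upwards [hfst.eventually h, self_mem_nhdsWithin] with p hp hpE
  rw [EReal.coe_le_coe_iff]
  have hpos : 0 < ‖p - WithLp.toLp 1 (x, (f x).toReal)‖ := norm_pos_iff.2 (sub_ne_zero.2 hpE.2)
  rw [div_le_iff₀ hpos, norm_eq_fst_add_abs_snd]
  have h1 := hp p.snd hpE.1
  have h2 : graphFunctional q (p - WithLp.toLp 1 (x, (f x).toReal)) =
      q (p.fst - x) - (p.snd - r) := by
    simp [graphFunctional, hfx]
  rw [h2]
  have h3 : (p - WithLp.toLp 1 (x, (f x).toReal)).fst = p.fst - x := by simp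
  rw [h3]
  have h4 : 0 ≤ e * |(p - WithLp.toLp 1 (x, (f x).toReal)).snd| := by positivity
  linarith

/-- A geometric `ε`-subgradient `q` is an analytic `τ`-subgradient, where `τ` also depends
on `‖q‖`. Where the inequality fails, the point of the graph of its left-hand side lies in the
epigraph of `f` and violates `ε'`-normality. -/
theorem eventually_of_mem_geomSubdiff {X : Type*} [NormedAddCommGroup X] [NormedSpace ℝ X]
    {f : X → EReal} {x : X} {ε ε' τ : ℝ} {q : StrongDual ℝ X} (hq : q ∈ geomSubdiff ε f x)
    (hε : ε < ε') (hτ0 : 0 ≤ τ) (hε' : 0 ≤ ε') (hτ : ε' * (1 + ‖q‖ + τ) ≤ τ) :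
    ∀ᶠ z in 𝓝 x, ∀ s : ℝ, f z ≤ s → (f x).toReal + q (z - x) - τ * ‖z - x‖ ≤ s := by
  obtain ⟨hf1, hf2, hlim⟩ := hq
  have hev := eventually_lt_of_limsup_lt (hlim.trans_lt (EReal.coe_lt_coe_iff.2 hε))
  rw [eventually_nhdsWithin_iff] at hev
  let P : X → WithLp 1 (X × ℝ) := fun z =>
    WithLp.toLp 1 (z, (f x).toReal + q (z - x) - τ * ‖z - x‖)
  have hP : Continuous P := (WithLp.prod_continuous_toLp 1 X ℝ).comp (by fun_prop)
  have hPx : P x = WithLp.toLp 1 (x, (f x).toReal) := by simp [P]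
  have hev' := (hPx ▸ hP.tendsto x).eventually hev
  filter_upwards [hev'] with z hz s hs
  by_contra! hlt
  have hzx : z ≠ x := by
    rintro rfl
    rw [← EReal.coe_toReal hf1 hf2, EReal.coe_le_coe_iff] at hs
    simp at hlt
    linarith
  have hpos : 0 < ‖z - x‖ := norm_pos_iff.2 (sub_ne_zero.2 hzx)
  have hne : P z ≠ WithLp.toLp 1 (x, (f x).toReal) := fun h => hzx (by
    simpa [P] using congrArg WithLp.fst h)
  have h1 := hz ⟨hs.trans (EReal.coe_le_coe_iff.2 hlt.le), hne⟩
  rw [EReal.coe_lt_coe_iff, div_lt_iff₀ (norm_pos_iff.2 (sub_ne_zero.2 hne)),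
    norm_eq_fst_add_abs_snd] at h1
  have h2 : graphFunctional q (P z - WithLp.toLp 1 (x, (f x).toReal)) = τ * ‖z - x‖ := by
    simp [graphFunctional, P]; ring
  have h3 : (P z - WithLp.toLp 1 (x, (f x).toReal)).fst = z - x := by simp [P]
  have h4 : (P z - WithLp.toLp 1 (x, (f x).toReal)).snd = q (z - x) - τ * ‖z - x‖ := by
    simp [P]; ring
  rw [h2, h3, h4] at h1
  have h5 : |q (z - x) - τ * ‖z - x‖| ≤ ‖q‖ * ‖z - x‖ + τ * ‖z - x‖ := by
    refine (abs_sub _ _).trans (add_le_add (q.le_opNorm _) ?_)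
    rw [abs_of_nonneg (by positivity)]
  have h6 := mul_le_mul_of_nonneg_left h5 hε'
  nlinarith

/-! ### The decoupled penalized minimum -/

/-- Doubling of variables. Let `G` be the epigraph of a function `g` with `g xb ≤ b`, and let
`a + g - q` have a `τ`-minimum at `xb` over `S`. For large `k`, the penalized function
`a x + g y - q y + (τ + c) * ‖y - xb‖ + k / 2 * ‖x - y‖ ^ 2` then has a `δ`-minimum in the sense of
Ekeland near `(xb, xb)`. The Lipschitz property of `a` bounds the multiplier `k * ‖x - y‖`,
whatever the size of `k`. -/
theorem exists_decoupled_minimum {X : Type*} [NormedAddCommGroup X] [NormedSpace ℝ X]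
    [CompleteSpace X] {S : Set X} (hS : IsClosed S) {xb : X} (hxb : xb ∈ S) {ρ : ℝ}
    (hSρ : ∀ x ∈ S, ‖x - xb‖ ≤ ρ) {a : X → ℝ} {ℓ : ℝ} (hℓ : 0 ≤ ℓ)
    (ha : ∀ x ∈ S, ∀ y ∈ S, |a x - a y| ≤ ℓ * ‖x - y‖) {G : Set (X × ℝ)} (hG : IsClosed G)
    (hGS : ∀ p ∈ G, p.1 ∈ S) {b : ℝ} (hb : (xb, b) ∈ G) {q : StrongDual ℝ X} {τ c δ r : ℝ}
    (hτ : 0 ≤ τ) (hc : 0 < c) (hδ : 0 < δ) (hr : 0 < r)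
    (hmin : ∀ p ∈ G, a xb + b + q (p.1 - xb) - τ * ‖p.1 - xb‖ ≤ a p.1 + p.2) :
    ∃ k : ℝ, 0 < k ∧ ∃ x ∈ S, ∃ (y : X) (s : ℝ), (y, s) ∈ G ∧ ‖x - xb‖ ≤ r ∧ ‖y - xb‖ ≤ r ∧
      |s - b| ≤ r ∧ k * ‖x - y‖ ≤ 2 * (ℓ + δ) ∧
      (∀ z ∈ S, a x + k / 2 * ‖x - y‖ ^ 2 ≤ a z + k / 2 * ‖z - y‖ ^ 2 + δ * ‖z - x‖) ∧
      ∀ p ∈ G, s + k / 2 * ‖x - y‖ ^ 2 ≤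
        p.2 - q (p.1 - y) + k / 2 * ‖p.1 - x‖ ^ 2 + (τ + c + δ) * ‖p.1 - y‖ := by
  have hq := norm_nonneg q
  -- `θ` will bound `‖x - y‖`, since `k * ‖x - y‖ ≤ 2 * (ℓ + δ) = k * θ`
  obtain ⟨θ, hθ, hθr⟩ : ∃ θ : ℝ, 0 < θ ∧ (1 + ℓ + ‖q‖ + τ) * (θ * (1 + ℓ / c)) = r :=
    ⟨r / ((1 + ℓ + ‖q‖ + τ) * (1 + ℓ / c)), by positivity, by field_simp⟩
  obtain ⟨k, hk, hkθ⟩ : ∃ k : ℝ, 0 < k ∧ k * θ = 2 * (ℓ + δ) :=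
    ⟨2 * (ℓ + δ) / θ, by positivity, by field_simp⟩
  -- the extra slope `c` of `Φ` at `xb` forces the second component of the minimum close to `xb`
  let Φ : X × X → ℝ := fun w =>
    a w.1 - q (w.2 - xb) + (τ + c) * ‖w.2 - xb‖ + k / 2 * ‖w.1 - w.2‖ ^ 2
  let E : Set ((X × X) × ℝ) := {p | p.1.1 ∈ S} ∩ (fun p => (p.1.2, p.2 - Φ p.1)) ⁻¹' G
  have hacont : ContinuousOn a S :=
    (LipschitzOnWith.of_dist_le_mul (K := ⟨ℓ, hℓ⟩) fun x hx y hy => by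
      rw [Real.dist_eq, dist_eq_norm]; exact ha x hx y hy).continuousOn
  have hE : IsClosed E := by
    refine ContinuousOn.preimage_isClosed_of_isClosed ?_
      (hS.preimage (by fun_prop : Continuous fun p : (X × X) × ℝ => p.1.1)) hG
    have h1 : ContinuousOn (fun p : (X × X) × ℝ => a p.1.1) {p | p.1.1 ∈ S} :=
      hacont.comp (by fun_prop) fun p hp => hp
    refine ContinuousOn.prodMk (by fun_prop) ?_
    refine ContinuousOn.sub (by fun_prop) ?_
    exact ((h1.sub (by fun_prop)).add (by fun_prop)).add (by fun_prop)
  have hlow : ∀ p ∈ E, a xb + b - ℓ * ‖p.1.1 - p.1.2‖ + c * ‖p.1.2 - xb‖ ≤ p.2 := by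
    rintro ⟨⟨x, y⟩, R⟩ ⟨hx, hy⟩
    have h1 := hmin _ hy
    have h2 := (abs_le.1 (ha x hx y (hGS _ hy))).1
    have h3 : 0 ≤ k / 2 * ‖x - y‖ ^ 2 := by positivity
    simp only [Φ] at h1 ⊢
    linarith
  have hm : ∀ p ∈ E, a xb + b - ℓ * (2 * ρ) ≤ p.2 := by
    intro p hp
    have h1 := hlow p hp
    have h2 : ‖p.1.1 - p.1.2‖ ≤ 2 * ρ := by
      have := norm_sub_le_norm_sub_add_norm_sub p.1.1 xb p.1.2
      rw [norm_sub_rev xb] at this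
      linarith [hSρ _ hp.1, hSρ _ (hGS _ hp.2)]
    have h3 := mul_le_mul_of_nonneg_left h2 hℓ
    have h4 : 0 ≤ c * ‖p.1.2 - xb‖ := by positivity
    linarith
  have hp₀ : ((xb, xb), a xb + b) ∈ E := ⟨hxb, by simpa [Φ] using hb⟩
  obtain ⟨⟨⟨x, y⟩, R⟩, hpE, hR, hvar⟩ := exists_phelps_minimal hE hm hp₀ hδ
  obtain ⟨hx, hy⟩ := id hpE
  obtain ⟨s, hs⟩ : ∃ s, s = R - Φ (x, y) := ⟨_, rfl⟩
  simp only [Set.mem_preimage, ← hs] at hy hx hR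
  have hyS : y ∈ S := hGS _ hy
  -- minimality in each component separately, the other one being kept fixed
  have hvx : ∀ z ∈ S, a x + k / 2 * ‖x - y‖ ^ 2 ≤ a z + k / 2 * ‖z - y‖ ^ 2 + δ * ‖z - x‖ := by
    intro z hz
    have h := hvar ((z, y), s + Φ (z, y)) ⟨hz, by simpa using hy⟩
    rw [Prod.dist_eq] at h
    simp only [dist_self, dist_eq_norm, sup_of_le_left, norm_nonneg] at h
    simp only [Φ] at h hs
    linarith
  have hvy : ∀ p ∈ G, s + k / 2 * ‖x - y‖ ^ 2 ≤
      p.2 - q (p.1 - y) + k / 2 * ‖p.1 - x‖ ^ 2 + (τ + c + δ) * ‖p.1 - y‖ := by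
    rintro ⟨z, s'⟩ hz
    have h := hvar ((x, z), s' + Φ (x, z)) ⟨hx, by simpa using hz⟩
    rw [Prod.dist_eq] at h
    simp only [dist_self, dist_eq_norm, sup_of_le_right, norm_nonneg] at h
    simp only [Φ] at h hs
    have h1 : (τ + c) * ‖z - xb‖ ≤ (τ + c) * (‖z - y‖ + ‖y - xb‖) := by
      gcongr; exact norm_sub_le_norm_sub_add_norm_sub _ _ _
    rw [norm_sub_rev x z] at h
    simp only [map_sub] at *
    linarith
  -- compare the first component with `y` itself and use the Lipschitz property of `a`
  have hkd : k * ‖x - y‖ ≤ 2 * (ℓ + δ) := by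
    have h1 := hvx y hyS
    have h2 := (abs_le.1 (ha x hx y hyS)).1
    rw [sub_self, norm_zero, norm_sub_rev y x] at h1
    rcases (norm_nonneg (x - y)).eq_or_lt with h0 | h0
    · rw [← h0]; simp; positivity
    · refine le_of_mul_le_mul_right ?_ h0
      nlinarith
  have hd : ‖x - y‖ ≤ θ := by
    refine le_of_mul_le_mul_left ?_ hk
    rw [hkθ]; exact hkd
  have hyb : ‖y - xb‖ ≤ ℓ / c * θ := by
    have h1 := hlow _ hpE
    have h2 := mul_le_mul_of_nonneg_left hd hℓ
    rw [div_mul_eq_mul_div, le_div_iff₀ hc]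
    simp only at h1
    linarith
  have hxb' : ‖x - xb‖ ≤ θ * (1 + ℓ / c) := by
    have := norm_sub_le_norm_sub_add_norm_sub x y xb
    linarith
  have hyb' : ‖y - xb‖ ≤ θ * (1 + ℓ / c) := by linarith
  have hθ' : 0 < θ * (1 + ℓ / c) := by positivity
  set θ' := θ * (1 + ℓ / c)
  have hqy : |q (y - xb)| ≤ ‖q‖ * θ' :=
    (q.le_opNorm _).trans (mul_le_mul_of_nonneg_left hyb' hq)
  have hle : θ' ≤ r := by
    rw [← hθr]; exact le_mul_of_one_le_left hθ'.le (by linarith)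
  refine ⟨k, hk, x, hx, y, s, hy, hxb'.trans hle, hyb'.trans hle, ?_, hkd, hvx, hvy⟩
  have h1 := hmin _ hy
  have h2 := abs_le.1 (ha x hx xb hxb)
  have h3 := abs_le.1 (ha y hyS xb hxb)
  have h4 := mul_le_mul_of_nonneg_left hxb' hℓ
  have h5 := mul_le_mul_of_nonneg_left hyb' hℓ
  have h6 := mul_le_mul_of_nonneg_left hyb' hτ
  have h7 := abs_le.1 hqy
  have h8 : 0 ≤ (τ + c) * ‖y - xb‖ + k / 2 * ‖x - y‖ ^ 2 := by positivity
  have h9 : 0 ≤ τ * θ' := by positivity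
  simp only [Φ] at hs h1
  rw [abs_le]
  constructor <;> linarith

/-- First-order upper estimate of the penalty term, which turns the minimality of a penalized
function into a subgradient inequality. -/
theorem HasFrechetNorm.eventually_smul_sq_le {X : Type*} [NormedAddCommGroup X]
    [NormedSpace ℝ X] (h : HasFrechetNorm X) {k e : ℝ} (hk : 0 < k) (he : 0 < e) (z w : X) :
    ∀ᶠ z' in 𝓝 z, k / 2 * ‖z' - w‖ ^ 2 ≤
      k / 2 * ‖z - w‖ ^ 2 + dualityGrad (k • (z - w)) (z' - z) + e * ‖z' - z‖ := by
  have h1 := (h.differentiable (z - w)).hasFDerivAt.isLittleO.def (show 0 < e / k by positivity)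
  have h2 : Tendsto (fun z' => z' - w) (𝓝 z) (𝓝 (z - w)) :=
    (continuous_id.sub continuous_const).tendsto z
  filter_upwards [h2.eventually h1] with z' hz'
  rw [sub_sub_sub_cancel_right] at hz'
  have h3 := (le_abs_self _).trans hz'
  rw [h.dualityGrad_smul]
  have h4 : fderiv ℝ (fun y : X => ‖y‖ ^ 2 / 2) (z - w) = dualityGrad (z - w) := rfl
  rw [h4] at h3
  have h5 := mul_le_mul_of_nonneg_left h3 hk.le
  have h6 : k * (e / k * ‖z' - z‖) = e * ‖z' - z‖ := by field_simp
  rw [h6] at h5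
  simp only [smul_apply, smul_eq_mul]
  linarith

theorem coe_toReal_add_of_addTop_ne {X : Type*} {f g : X → EReal} {x : X}
    (h1 : addTop f g x ≠ ⊤) (h2 : addTop f g x ≠ ⊥) :
    g x ≠ ⊤ ∧ g x ≠ ⊥ ∧ (addTop f g x).toReal = (f x).toReal + (g x).toReal := by
  unfold addTop at *
  split_ifs at * with h
  · exact absurd rfl h1
  · push Not at h
    rw [Ne, EReal.add_eq_bot_iff, not_or] at h2
    exact ⟨h.2, h2.2, EReal.toReal_add h.1 h2.1 h.2 h2.2⟩

theorem isClosed_real_epigraph {X : Type*} [TopologicalSpace X] {f : X → EReal} {S : Set X}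
    (hS : IsClosed S) (hf : LowerSemicontinuousOn f S) :
    IsClosed {p : X × ℝ | p.1 ∈ S ∧ f p.1 ≤ (p.2 : EReal)} :=
  ((lowerSemicontinuousOn_iff_isClosed_epigraph hS).1 hf).preimage
    (continuous_fst.prodMk (continuous_coe_real_ereal.comp continuous_snd))

theorem restrictTop_of_mem {X : Type*} {f : X → EReal} {Ω : Set X} {x : X} (hx : x ∈ Ω) :
    restrictTop f Ω x = f x := if_pos hx

theorem mem_of_restrictTop_le {X : Type*} {f : X → EReal} {Ω : Set X} {x : X} {s : ℝ}
    (h : restrictTop f Ω x ≤ (s : EReal)) : x ∈ Ω ∧ f x ≤ (s : EReal) := by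
  unfold restrictTop at h
  split_ifs at h with hx
  · exact ⟨hx, h⟩
  · simp at h

/-! ### The fuzzy sum rule -/

/-- For convex `Ω`, gradients of the penalty pointing from `x` to another point of `Ω` lie in the
duality image of the tangent cone at `x`. -/
theorem smul_dualityGrad_mem_dualityImage {X : Type*} [NormedAddCommGroup X] [NormedSpace ℝ X]
    (h : HasFrechetNorm X) {Ω : Set X} (hΩ : Convex ℝ Ω) {x u : X} (hx : x ∈ Ω) (hu : u ∈ Ω)
    {t : ℝ} (ht : 0 < t) : dualityGrad (t • (u - x)) ∈ dualityImage (tangentCone x Ω) :=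
  Set.mem_iUnion₂.2 ⟨_, smul_sub_mem_tangentCone hΩ hx hu ht, h.dualityGrad_mem _⟩

/-- An element of `J (T (x, Ω))` is approximated, uniformly in `y` near `x`, by elements
`J (t • (u - y))` with `u ∈ Ω`; for `y ∈ Ω` these belong to `J (T (y, Ω))`. -/
theorem exists_dualityGrad_approx {X : Type*} [NormedAddCommGroup X] [NormedSpace ℝ X]
    (h : HasFrechetNorm X) {Ω : Set X} (hΩ : Convex ℝ Ω) {x : X} (hx : x ∈ Ω)
    {xs : StrongDual ℝ X} (hxs : xs ∈ dualityImage (tangentCone x Ω)) {η : ℝ} (hη : 0 < η) :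
    ∃ t : ℝ, 0 < t ∧ ∃ u ∈ Ω, ∃ r : ℝ, 0 < r ∧
      ∀ y, ‖y - x‖ ≤ r → ‖xs - dualityGrad (t • (u - y))‖ ≤ η := by
  obtain ⟨v, hv, hxv⟩ := Set.mem_iUnion₂.1 hxs
  obtain rfl := h.eq_dualityGrad hxv
  rw [tangentCone_eq_closure hΩ hx] at hv
  obtain ⟨r, hr, hball⟩ := Metric.continuousAt_iff.1 (h.continuous_dualityGrad.continuousAt (x := v))
    η hη
  obtain ⟨_, ⟨t, ht, u, hu, rfl⟩, hd⟩ := Metric.mem_closure_iff.1 hv (r / 2) (by positivity)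
  refine ⟨t, ht, u, hu, r / (2 * t), by positivity, fun y hy => ?_⟩
  rw [← dist_eq_norm, dist_comm]
  refine (hball ?_).le
  have h1 : dist (t • (u - y)) (t • (u - x)) ≤ r / 2 := by
    rw [dist_eq_norm, ← smul_sub, sub_sub_sub_cancel_left, norm_smul, Real.norm_of_nonneg ht.le,
      norm_sub_rev]
    calc t * ‖y - x‖ ≤ t * (r / (2 * t)) := by gcongr
      _ = r / 2 := by field_simp
  have h2 := dist_triangle_right (t • (u - y)) v (t • (u - x))
  linarith

/-- The fuzzy sum rule with explicit constants. The bound on `‖xs₁‖`, which depends only on the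
Lipschitz modulus and on `η`, is what allows passing to the limit in the exact sum rule. -/
theorem exists_fuzzy_sum {X : Type*} [NormedAddCommGroup X] [NormedSpace ℝ X] [CompleteSpace X]
    (hnorm : HasFrechetNorm X) {Ω : Set X} (hΩclosed : IsClosed Ω) (hΩ : Convex ℝ Ω)
    {f₁ f₂ : X → EReal} {xb : X} {ρ ℓ : ℝ} (hρ : 0 < ρ) (hℓ : 0 ≤ ℓ)
    (hfin : ∀ x ∈ Metric.closedBall xb ρ ∩ Ω, f₁ x ≠ ⊤ ∧ f₁ x ≠ ⊥)
    (hlip : ∀ x ∈ Metric.closedBall xb ρ ∩ Ω, ∀ y ∈ Metric.closedBall xb ρ ∩ Ω,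
      |(f₁ x).toReal - (f₁ y).toReal| ≤ ℓ * ‖x - y‖)
    (hlsc : ∀ x ∈ Metric.closedBall xb ρ ∩ Ω, LowerSemicontinuousWithinAt f₂ Ω x)
    (hJ : ∀ x ∈ Metric.closedBall xb ρ ∩ Ω, Convex ℝ (dualityImage (tangentCone x Ω)))
    {ε η C : ℝ} (hε0 : 0 ≤ ε) (hε : ε < 1 / 2) (hη : ε < η) {xs : StrongDual ℝ X}
    (hxs : xs ∈ regSubdiff ε Ω (addTop f₁ f₂) xb) (hC : (6 + 2 * ‖xs‖) * η ≤ C) :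
    ∃ (x₁ x₂ : X) (xs₁ xs₂ : StrongDual ℝ X),
      ‖x₁ - xb‖ ≤ η ∧ |(f₁ x₁).toReal - (f₁ xb).toReal| ≤ η ∧
      ‖x₂ - xb‖ ≤ η ∧ |(f₂ x₂).toReal - (f₂ xb).toReal| ≤ η ∧
      xs₁ ∈ regSubdiff C Ω f₁ x₁ ∧ xs₂ ∈ regSubdiff C Ω f₂ x₂ ∧
      ‖xs - (xs₁ + xs₂)‖ ≤ η ∧ ‖xs₁‖ ≤ 2 * (ℓ + η) := by
  obtain ⟨hxbΩ, hgeom, himage⟩ := hxs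
  have hη0 : 0 < η := hε0.trans_lt hη
  have hq := norm_nonneg xs
  -- with `ε' = min η (1 / 2)` this `τ` satisfies `ε' * (1 + ‖xs‖ + τ) ≤ τ`
  obtain ⟨τ, hτ⟩ : ∃ τ, τ = 2 * η * (1 + ‖xs‖) := ⟨_, rfl⟩
  have hτ0 : 0 ≤ τ := by rw [hτ]; positivity
  have hηC : τ + 4 * η ≤ C := by rw [hτ]; linarith
  have hC0 : 0 ≤ C := by linarith
  have hfx := restrictTop_of_mem (f := addTop f₁ f₂) hxbΩ
  have hev := eventually_of_mem_geomSubdiff hgeom (lt_min hη hε) hτ0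
    (by positivity) (by
      have h1 : min η (1 / 2) * (1 + ‖xs‖) ≤ η * (1 + ‖xs‖) := by gcongr; exact min_le_left _ _
      have h2 : min η (1 / 2) * τ ≤ 1 / 2 * τ := by gcongr; exact min_le_right _ _
      linarith)
  have hne := hgeom.1
  have hne' := hgeom.2.1
  rw [hfx] at hev hne hne'
  obtain ⟨hf₂t, hf₂b, hsum⟩ := coe_toReal_add_of_addTop_ne hne hne'
  rw [hsum] at hev
  obtain ⟨ρ', hρ', hball⟩ := Metric.nhds_basis_closedBall.eventually_iff.1 hev
  obtain ⟨σ, hσ, hσρ, hσρ'⟩ : ∃ σ, 0 < σ ∧ σ ≤ ρ ∧ σ ≤ ρ' :=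
    ⟨min ρ ρ', by positivity, min_le_left _ _, min_le_right _ _⟩
  obtain ⟨t, ht, u, hu, r₀, hr₀, happrox⟩ := exists_dualityGrad_approx hnorm hΩ hxbΩ himage hη0
  set S := Metric.closedBall xb σ ∩ Ω
  have hSρ : ∀ x ∈ S, x ∈ Metric.closedBall xb ρ ∩ Ω := fun x hx =>
    ⟨Metric.closedBall_subset_closedBall hσρ hx.1, hx.2⟩
  have hSclosed : IsClosed S := Metric.isClosed_closedBall.inter hΩclosed
  have hxbS : xb ∈ S := ⟨Metric.mem_closedBall_self hσ.le, hxbΩ⟩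
  have hreal : ∀ x ∈ S, f₁ x = ((f₁ x).toReal : EReal) := fun x hx =>
    (EReal.coe_toReal (hfin x (hSρ x hx)).1 (hfin x (hSρ x hx)).2).symm
  have hG := isClosed_real_epigraph hSclosed (f := f₂) fun x hx =>
    (hlsc x (hSρ x hx)).mono Set.inter_subset_right
  obtain ⟨r, hr, hrη, hrℓ, hrσ, hrr₀⟩ : ∃ r : ℝ, 0 < r ∧ r ≤ η ∧ ℓ * r ≤ η ∧ r < σ ∧ r ≤ r₀ := by
    refine ⟨min (η / (1 + ℓ)) (min (σ / 2) r₀), by positivity, ?_, ?_, ?_, ?_⟩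
    · exact (min_le_left _ _).trans (div_le_self hη0.le (by linarith))
    · calc ℓ * min (η / (1 + ℓ)) (min (σ / 2) r₀) ≤ (1 + ℓ) * (η / (1 + ℓ)) := by
            gcongr
            · linarith
            · exact min_le_left _ _
        _ = η := by field_simp
    · exact ((min_le_right _ _).trans (min_le_left _ _)).trans_lt (half_lt_self hσ)
    · exact (min_le_right _ _).trans (min_le_right _ _)
  obtain ⟨k, hk, x, hx, y, s, ⟨hyS, hys⟩, hxr, hyr, hsr, hkxy, hminx, hminy⟩ :=
    exists_decoupled_minimum (a := fun x => (f₁ x).toReal) (b := (f₂ xb).toReal) (q := xs)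
      hSclosed hxbS (fun x hx => mem_closedBall_iff_norm.1 hx.1) hℓ
      (fun x hx y hy => hlip x (hSρ x hx) y (hSρ y hy)) hG (fun p hp => hp.1)
      ⟨hxbS, EReal.le_coe_toReal hf₂t⟩ hτ0 hη0 hη0 hr (by
        rintro ⟨z, s⟩ ⟨hz, hzs⟩
        have hadd : restrictTop (addTop f₁ f₂) Ω z ≤ (((f₁ z).toReal + s : ℝ) : EReal) := by
          rw [restrictTop_of_mem hz.2, addTop, if_neg, EReal.coe_add, ← hreal z hz]
          · gcongr
          · rintro (h | h)
            · exact (hfin z (hSρ z hz)).1 h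
            · rw [h] at hzs; simp at hzs
        exact hball (Metric.closedBall_subset_closedBall hσρ' hz.1) _ hadd)
  -- the minimum found in the epigraph of `f₂` lies on its graph
  have hf₂y : f₂ y = (s : EReal) := by
    refine hys.eq_of_not_lt fun hlt => ?_
    obtain ⟨s', hs', hs's⟩ := EReal.lt_iff_exists_real_btwn.1 hlt
    have h := hminy (y, s') ⟨hyS, hs'.le⟩
    rw [norm_sub_rev y x] at h
    simp only [sub_self, map_zero, norm_zero, mul_zero] at h
    have := EReal.coe_lt_coe_iff.1 hs's
    linarith
  have hneg : dualityGrad (k • (x - y)) = -dualityGrad (k • (y - x)) := by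
    rw [← hnorm.dualityGrad_neg, ← smul_neg, neg_sub]
  have hnear : ∀ {z : X}, ‖z - xb‖ ≤ r → ∀ᶠ z' in 𝓝 z, z' ∈ Metric.closedBall xb σ := by
    intro z hz
    have : z ∈ Metric.ball xb σ := mem_ball_iff_norm.2 (hz.trans_lt hrσ)
    filter_upwards [Metric.isOpen_ball.mem_nhds this] with z' hz'
    exact Metric.ball_subset_closedBall hz'
  have hj := happrox y (hyr.trans hrr₀)
  obtain ⟨j, hjdef⟩ : ∃ j, j = dualityGrad (t • (u - y)) := ⟨_, rfl⟩
  rw [← hjdef] at hj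
  -- the penalty gradients cancel in the sum, and `j` replaces `xs`, which need not belong to
  -- the duality image at `y`
  refine ⟨x, y, dualityGrad (k • (y - x)), dualityGrad (k • (x - y)) + j, hxr.trans hrη, ?_,
    hyr.trans hrη, ?_, ⟨hx.2, ?_, ?_⟩, ⟨hyS.2, ?_, ?_⟩, ?_, ?_⟩
  · refine (hlip x (hSρ x hx) xb (hSρ xb hxbS)).trans (le_trans ?_ hrℓ)
    gcongr
  · rw [hf₂y, EReal.toReal_coe]
    exact hsr.trans hrη
  · refine mem_geomSubdiff_of_eventually ((restrictTop_of_mem hx.2).trans (hreal x hx)) hC0 ?_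
    filter_upwards [hnear hxr, hnorm.eventually_smul_sq_le hk hη0 x y] with z hz hzsq s' hs'
    obtain ⟨hzΩ, hzs'⟩ := mem_of_restrictTop_le hs'
    have hzS : z ∈ S := ⟨hz, hzΩ⟩
    rw [hreal z hzS, EReal.coe_le_coe_iff] at hzs'
    have h1 := hminx z hzS
    rw [hneg] at hzsq
    rw [neg_apply] at hzsq
    have h2 : 2 * η * ‖z - x‖ ≤ C * ‖z - x‖ := by gcongr; linarith
    linarith
  · exact smul_dualityGrad_mem_dualityImage hnorm hΩ hx.2 hyS.2 hk
  · refine mem_geomSubdiff_of_eventually ((restrictTop_of_mem hyS.2).trans hf₂y) hC0 ?_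
    filter_upwards [hnear hyr, hnorm.eventually_smul_sq_le hk hη0 y x] with z hz hzsq s' hs'
    obtain ⟨hzΩ, hzs'⟩ := mem_of_restrictTop_le hs'
    have h1 := hminy (z, s') ⟨⟨hz, hzΩ⟩, hzs'⟩
    rw [norm_sub_rev x y] at h1
    have h2 : (τ + 4 * η) * ‖z - y‖ ≤ C * ‖z - y‖ := by gcongr
    have h3 : j (z - y) - xs (z - y) ≤ η * ‖z - y‖ := by
      have h4 := (xs - j).le_of_opNorm_le hj (z - y)
      rw [Real.norm_eq_abs, sub_apply] at h4
      linarith [neg_abs_le (xs (z - y) - j (z - y))]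
    rw [hneg, add_apply, neg_apply]
    simp only at h1
    linarith
  · rw [hjdef]
    exact add_mem_dualityImage_tangentCone (hJ y (hSρ y hyS))
      (smul_dualityGrad_mem_dualityImage hnorm hΩ hyS.2 hx.2 hk)
      (smul_dualityGrad_mem_dualityImage hnorm hΩ hyS.2 hu ht)
  · rwa [hneg, add_neg_cancel_left]
  · rw [hnorm.norm_dualityGrad, norm_smul, Real.norm_of_nonneg hk.le, norm_sub_rev]
    exact hkxy

/-! ### The exact sum rule -/

theorem tendsto_of_abs_toReal_sub_le {f : ℕ → EReal} {u : ℕ → ℝ} {e : ℕ → ℝ} {l : EReal}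
    (hl : l ≠ ⊤ ∧ l ≠ ⊥) (hf : ∀ k, f k ≠ ⊤ ∧ f k ≠ ⊥) (hu : Tendsto u atTop (𝓝 l.toReal))
    (he : Tendsto e atTop (𝓝 0)) (h : ∀ k, |(f k).toReal - u k| ≤ e k) :
    Tendsto f atTop (𝓝 l) := by
  have h1 : Tendsto (fun k => (f k).toReal - u k) atTop (𝓝 0) :=
    squeeze_zero_norm h he
  have h2 : Tendsto (fun k => (f k).toReal) atTop (𝓝 l.toReal) := by
    simpa using h1.add hu
  have h3 := (continuous_coe_real_ereal.tendsto l.toReal).comp h2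
  rw [EReal.coe_toReal hl.1 hl.2] at h3
  exact h3.congr fun k => EReal.coe_toReal (hf k).1 (hf k).2

theorem ne_top_and_ne_bot_of_mem_regSubdiff {X : Type*} [NormedAddCommGroup X]
    [NormedSpace ℝ X] {ε : ℝ} {Ω : Set X} {f : X → EReal} {x : X} {xs : StrongDual ℝ X}
    (h : xs ∈ regSubdiff ε Ω f x) : f x ≠ ⊤ ∧ f x ≠ ⊥ := by
  have h1 := h.2.1.1
  have h2 := h.2.1.2.1
  rw [restrictTop_of_mem h.1] at h1 h2
  exact ⟨h1, h2⟩

/-- The local hypotheses of the sum rules hold on a common closed ball. -/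
theorem exists_closedBall_data {X : Type*} [NormedAddCommGroup X] [NormedSpace ℝ X]
    {Ω : Set X} {xb : X} {f₁ f₂ : X → EReal} {ℓ : ℝ}
    (hf₁ : LocLipschitzRel f₁ Ω xb ℓ) (hf₂ : LscRelAround f₂ Ω xb)
    (hJ : ∀ᶠ x in 𝓝[Ω] xb, Convex ℝ (dualityImage (tangentCone x Ω))) :
    ∃ ρ : ℝ, 0 < ρ ∧
      (∀ x ∈ Metric.closedBall xb ρ ∩ Ω, f₁ x ≠ ⊤ ∧ f₁ x ≠ ⊥) ∧
      (∀ x ∈ Metric.closedBall xb ρ ∩ Ω, ∀ y ∈ Metric.closedBall xb ρ ∩ Ω,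
        |(f₁ x).toReal - (f₁ y).toReal| ≤ ℓ * ‖x - y‖) ∧
      (∀ x ∈ Metric.closedBall xb ρ ∩ Ω, LowerSemicontinuousWithinAt f₂ Ω x) ∧
      ∀ x ∈ Metric.closedBall xb ρ ∩ Ω, Convex ℝ (dualityImage (tangentCone x Ω)) := by
  obtain ⟨U, hU, hfin, hlip⟩ := hf₁
  obtain ⟨V, hV, hlsc⟩ := hf₂
  rw [eventually_nhdsWithin_iff] at hJ
  obtain ⟨ρ, hρ, hball⟩ := Metric.nhds_basis_closedBall.eventually_iff.1
    ((eventually_mem_set.2 hU).and ((eventually_mem_set.2 hV).and hJ))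
  exact ⟨ρ, hρ, fun x hx => hfin x ⟨(hball hx.1).1, hx.2⟩,
    fun x hx y hy => hlip x ⟨(hball hx.1).1, hx.2⟩ y ⟨(hball hy.1).1, hy.2⟩,
    fun x hx => hlsc x ⟨(hball hx.1).2.1, hx.2⟩, fun x hx => (hball hx.1).2.2 hx.2⟩

/-- The exact sum rule. The fuzzy rule is applied at the points approaching `xb`; the first
summands are bounded, so a subsequence of them converges weak*, and the second summands converge
along the same subsequence. -/
theorem limSubdiff_addTop_subset {X : Type*} [NormedAddCommGroup X] [NormedSpace ℝ X]
    [CompleteSpace X] (hrefl : IsReflexive X) (hnorm : HasFrechetNorm X) {Ω : Set X}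
    (hΩclosed : IsClosed Ω) (hΩ : Convex ℝ Ω) {f₁ f₂ : X → EReal} {xb : X} {ℓ : ℝ} (hℓ : 0 ≤ ℓ)
    (hf₁ : LocLipschitzRel f₁ Ω xb ℓ) (hf₂ : LscRelAround f₂ Ω xb)
    (hJ : ∀ᶠ x in 𝓝[Ω] xb, Convex ℝ (dualityImage (tangentCone x Ω))) :
    limSubdiff Ω (addTop f₁ f₂) xb ⊆ limSubdiff Ω f₁ xb + limSubdiff Ω f₂ xb := by
  obtain ⟨ρ, hρ, hfin, hlip, hlsc, hconv⟩ := exists_closedBall_data hf₁ hf₂ hJ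
  rintro xs ⟨hxb, hne, hne', e, z, zs, he, heanti, he0, hzΩ, hz, hfz, hzs, hreg⟩
  obtain ⟨M, hM⟩ := exists_norm_bound_of_weakStar_tendsto hzs
  have hM0 : 0 ≤ M := (norm_nonneg _).trans (hM 0)
  obtain ⟨N, hN⟩ := eventually_atTop.1 ((hz.eventually (Metric.closedBall_mem_nhds xb
    (half_pos hρ))).and (he0.eventually (gt_mem_nhds (show (0 : ℝ) < 1 / 2 by norm_num))))
  -- `e k < η k` is required by the fuzzy rule, and `η` must still be antitone
  let η : ℕ → ℝ := fun k => e (k + N) + 1 / ((k : ℝ) + 1)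
  have heN : Tendsto (fun k => e (k + N)) atTop (𝓝 0) := (tendsto_add_atTop_iff_nat N).2 he0
  have hη0 : Tendsto η atTop (𝓝 0) := by
    simpa [η] using heN.add tendsto_one_div_add_atTop_nhds_zero_nat
  have hηpos : ∀ k, 0 < η k := fun k => add_pos (he _) (by positivity)
  have hηanti : Antitone η := fun i j hij =>
    add_le_add (heanti (by omega)) (one_div_le_one_div_of_le (by positivity) (by gcongr))
  have hη2 : ∀ k, η k ≤ 3 / 2 := fun k => by
    have h1 := (hN (k + N) (by omega)).2
    have h2 : 1 / ((k : ℝ) + 1) ≤ 1 := by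
      rw [div_le_one (by positivity)]; simp
    simp only [η]
    linarith
  have hzball : ∀ k, z (k + N) ∈ Metric.closedBall xb (ρ / 2) := fun k =>
    (hN (k + N) (by omega)).1
  have hsub : ∀ k, Metric.closedBall (z (k + N)) (ρ / 2) ∩ Ω ⊆ Metric.closedBall xb ρ ∩ Ω :=
    fun k => Set.inter_subset_inter_left _ (Metric.closedBall_subset_closedBall' (by
      have := Metric.mem_closedBall.1 (hzball k)
      linarith))
  have hzρ : ∀ k, z (k + N) ∈ Metric.closedBall xb ρ ∩ Ω := fun k =>
    hsub k ⟨Metric.mem_closedBall_self (by positivity), hzΩ _⟩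
  have hex := fun k => exists_fuzzy_sum hnorm hΩclosed hΩ (half_pos hρ) hℓ
    (fun x hx => hfin x (hsub k hx)) (fun x hx y hy => hlip x (hsub k hx) y (hsub k hy))
    (fun x hx => hlsc x (hsub k hx)) (fun x hx => hconv x (hsub k hx))
    (he (k + N)).le (hN (k + N) (by omega)).2
    (show e (k + N) < η k from lt_add_of_pos_right _ (by positivity)) (hreg (k + N))
    (C := (6 + 2 * M) * η k)
    (mul_le_mul_of_nonneg_right (by linarith [hM (k + N)]) (hηpos k).le)
  choose x₁ x₂ xs₁ xs₂ hx₁ hfx₁ hx₂ hfx₂ hreg₁ hreg₂ hsum hbound using hex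
  obtain ⟨g, φ, hφ, hg⟩ := exists_weakStar_convergent_subseq hrefl (g := xs₁)
    (B := 2 * (ℓ + 3 / 2)) fun k => (hbound k).trans (by linarith [hη2 k])
  have hηφ : Tendsto (fun k => η (φ k)) atTop (𝓝 0) := hη0.comp hφ.tendsto_atTop
  have hzφ : Tendsto (fun k => z (φ k + N)) atTop (𝓝 xb) :=
    ((tendsto_add_atTop_iff_nat N).2 hz).comp hφ.tendsto_atTop
  have hCφ : Tendsto (fun k => (6 + 2 * M) * η (φ k)) atTop (𝓝 0) := by
    simpa using hηφ.const_mul (6 + 2 * M)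
  have hCanti : Antitone fun k => (6 + 2 * M) * η (φ k) := fun i j hij =>
    mul_le_mul_of_nonneg_left (hηanti (hφ.monotone hij)) (by positivity)
  have hCpos : ∀ k, 0 < (6 + 2 * M) * η (φ k) := fun k => mul_pos (by positivity) (hηpos _)
  have hlim : ∀ x : ℕ → X, (∀ k, ‖x k - z (k + N)‖ ≤ η k) →
      Tendsto (fun k => x (φ k)) atTop (𝓝 xb) := fun x hx => by
    have h1 : Tendsto (fun k => x (φ k) - z (φ k + N)) atTop (𝓝 0) :=
      squeeze_zero_norm (fun k => hx (φ k)) hηφ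
    simpa using h1.add hzφ
  have hxbρ : xb ∈ Metric.closedBall xb ρ ∩ Ω := ⟨Metric.mem_closedBall_self hρ.le, hxb⟩
  -- the values of `f₁`, hence also those of `f₂`, converge along the base points
  have hf₁z : Tendsto (fun k => (f₁ (z (φ k + N))).toReal) atTop (𝓝 (f₁ xb).toReal) := by
    rw [tendsto_iff_norm_sub_tendsto_zero] at hzφ ⊢
    refine squeeze_zero (fun _ => norm_nonneg _) (fun k => hlip _ (hzρ (φ k)) _ hxbρ) ?_
    simpa using hzφ.const_mul ℓ
  obtain ⟨hf₂t, hf₂b, hval⟩ := coe_toReal_add_of_addTop_ne hne hne'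
  have hf₂z : Tendsto (fun k => (f₂ (z (φ k + N))).toReal) atTop (𝓝 (f₂ xb).toReal) := by
    have h1 : Tendsto (fun k => (addTop f₁ f₂ (z (φ k + N))).toReal) atTop
        (𝓝 (addTop f₁ f₂ xb).toReal) :=
      ((EReal.tendsto_toReal hne hne').comp
        ((tendsto_add_atTop_iff_nat N).2 hfz)).comp hφ.tendsto_atTop
    have h2 := h1.sub hf₁z
    rw [hval, add_sub_cancel_left] at h2
    refine h2.congr fun k => ?_
    have h3 := ne_top_and_ne_bot_of_mem_regSubdiff (hreg (φ k + N))
    rw [(coe_toReal_add_of_addTop_ne h3.1 h3.2).2.2, add_sub_cancel_left]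
  have hg₂ : Tendsto (fun k => StrongDual.toWeakDual (xs₂ (φ k))) atTop
      (𝓝 (StrongDual.toWeakDual (xs - g))) := by
    have h1 : Tendsto (fun k => zs (φ k + N) - (xs₁ (φ k) + xs₂ (φ k))) atTop (𝓝 0) :=
      squeeze_zero_norm (fun k => hsum (φ k)) hηφ
    have h2 := (NormedSpace.Dual.toWeakDual_continuous.tendsto
      (0 : StrongDual ℝ X)).comp h1
    have h3 := (((tendsto_add_atTop_iff_nat N).2 hzs).comp hφ.tendsto_atTop).sub hg |>.sub h2
    simp only [map_sub, map_zero, sub_zero] at h3 ⊢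
    refine h3.congr fun k => ?_
    simp
  refine ⟨g, ⟨hxb, (hfin xb hxbρ).1, (hfin xb hxbρ).2, _, _, _, hCpos, hCanti, hCφ,
    fun k => (hreg₁ (φ k)).1, hlim x₁ hx₁, ?_, hg, fun k => hreg₁ (φ k)⟩, xs - g,
    ⟨hxb, hf₂t, hf₂b, _, _, _, hCpos, hCanti, hCφ, fun k => (hreg₂ (φ k)).1, hlim x₂ hx₂, ?_, hg₂,
      fun k => hreg₂ (φ k)⟩, add_sub_cancel _ _⟩
  · exact tendsto_of_abs_toReal_sub_le (hfin xb hxbρ)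
      (fun k => ne_top_and_ne_bot_of_mem_regSubdiff (hreg₁ (φ k))) hf₁z hηφ fun k => hfx₁ (φ k)
  · exact tendsto_of_abs_toReal_sub_le ⟨hf₂t, hf₂b⟩
      (fun k => ne_top_and_ne_bot_of_mem_regSubdiff (hreg₂ (φ k))) hf₂z hηφ fun k => hfx₂ (φ k)

end RelSubdiff

theorem theorem4p2 {X : Type u} [NormedAddCommGroup X] [NormedSpace ℝ X] [CompleteSpace X]
    (hrefl : RelSubdiff.IsReflexive X)
    (hX : RelSubdiff.IsLocallyUniformlyConvex X)
    (hXdual : RelSubdiff.IsLocallyUniformlyConvex (StrongDual ℝ X))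
    (hnorm : RelSubdiff.HasFrechetNorm X)
    (Ω : Set X) (hΩclosed : IsClosed Ω) (hΩconvex : Convex ℝ Ω)
    (xbar : X) (hxbar : xbar ∈ Ω)
    (f₁ f₂ : X → EReal) (ℓ : ℝ) (hℓ : 0 ≤ ℓ)
    (hf₁ : RelSubdiff.LocLipschitzRel f₁ Ω xbar ℓ)
    (hf₂ : RelSubdiff.LscRelAround f₂ Ω xbar)
    (hJ : ∀ᶠ x in 𝓝[Ω] xbar,
      Convex ℝ (RelSubdiff.dualityImage (RelSubdiff.tangentCone x Ω))) :
    -- Fuzzy sum rule; `ω M` is the rate at which `γ, η₁, η₂` vanish as `η → 0`.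
    (∃ ε₀ : ℝ, 0 < ε₀ ∧ ∃ ω : ℝ → ℝ → ℝ, (∀ M, Tendsto (ω M) (𝓝[>] 0) (𝓝 0)) ∧
      ∀ (M ε η : ℝ), 0 ≤ ε → ε < ε₀ → ε < η →
      ∀ xs ∈ RelSubdiff.regSubdiff ε Ω (RelSubdiff.addTop f₁ f₂) xbar, ‖xs‖ ≤ M →
        ∃ (γ η₁ η₂ : ℝ) (x₁ x₂ : X) (xs₁ xs₂ : StrongDual ℝ X),
          0 < γ ∧ γ ≤ ω M η ∧ 0 < η₁ ∧ η₁ ≤ ω M η ∧ 0 < η₂ ∧ η₂ ≤ ω M η ∧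
          x₁ ∈ Metric.closedBall xbar η ∧ |(f₁ x₁).toReal - (f₁ xbar).toReal| ≤ η ∧
          x₂ ∈ Metric.closedBall xbar η ∧ |(f₂ x₂).toReal - (f₂ xbar).toReal| ≤ η ∧
          xs₁ ∈ RelSubdiff.regSubdiff η₁ Ω f₁ x₁ ∧
          xs₂ ∈ RelSubdiff.regSubdiff η₂ Ω f₂ x₂ ∧
          xs ∈ Metric.closedBall (xs₁ + xs₂) γ) ∧
    -- Exact sum rule.
    RelSubdiff.limSubdiff Ω (RelSubdiff.addTop f₁ f₂) xbar ⊆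
      RelSubdiff.limSubdiff Ω f₁ xbar + RelSubdiff.limSubdiff Ω f₂ xbar ∧
    -- In a Hilbert space the convexity hypothesis `hJ` holds for every convex set.
    (∀ (H : Type u) [NormedAddCommGroup H] [InnerProductSpace ℝ H] [CompleteSpace H]
      (C : Set H), Convex ℝ C → ∀ x ∈ C,
        Convex ℝ (RelSubdiff.dualityImage (RelSubdiff.tangentCone x C))) := by
  refine ⟨⟨1 / 2, by norm_num, fun M η => (6 + 2 * M) * η, fun M => ?_, ?_⟩,
    RelSubdiff.limSubdiff_addTop_subset hrefl hnorm hΩclosed hΩconvex hℓ hf₁ hf₂ hJ,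
    fun H _ _ _ C hC x hx => RelSubdiff.convex_dualityImage_tangentCone_of_inner hC hx⟩
  · have h : Continuous fun η : ℝ => (6 + 2 * M) * η := by fun_prop
    simpa using (h.tendsto 0).mono_left nhdsWithin_le_nhds
  · intro M ε η hε0 hε hη xs hxs hM
    obtain ⟨ρ, hρ, hfin, hlip, hlsc, hconv⟩ := RelSubdiff.exists_closedBall_data hf₁ hf₂ hJ
    have hη0 : 0 < η := hε0.trans_lt hη
    have hM0 : 0 ≤ M := (norm_nonneg _).trans hM
    have hω : 0 < (6 + 2 * M) * η := by positivity
    obtain ⟨x₁, x₂, xs₁, xs₂, hx₁, hfx₁, hx₂, hfx₂, hreg₁, hreg₂, hsum, -⟩ :=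
      RelSubdiff.exists_fuzzy_sum hnorm hΩclosed hΩconvex hρ hℓ hfin hlip hlsc hconv hε0 hε hη hxs
        (C := (6 + 2 * M) * η) (mul_le_mul_of_nonneg_right (by linarith) hη0.le)
    refine ⟨(6 + 2 * M) * η, (6 + 2 * M) * η, (6 + 2 * M) * η, x₁, x₂, xs₁, xs₂, hω, le_rfl, hω,
      le_rfl, hω, le_rfl, mem_closedBall_iff_norm.2 hx₁, hfx₁, mem_closedBall_iff_norm.2 hx₂, hfx₂,
      hreg₁, hreg₂, mem_closedBall_iff_norm.2 (hsum.trans ?_)⟩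
    exact le_mul_of_one_le_left hη0.le (by linarith)
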